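/- Let $\mathcal H$ be a real Hilbert space, $L>0$, and let $F:\mathcal H\to\mathcal H$ be $(1/L)$-cocoercive, i.e. $\langle x-y,F(x)-F(y)\rangle\ge \frac1L\|F(x)-F(y)\|^2$ for all $x,y\in\mathcal H$. Let $B:\mathcal H\rightrightarrows\mathcal H$ be a maximal monotone operator and $C\subset\mathcal H$ a nonempty closed convex set containing the domain $\{x: B(x)\ne\emptyset\}$ of $B$. Assume that the solution set $\mathcal S=\{x : 0\in F(x)+B(x)\}$ is nonempty. For $\varepsilon\ge0$ let $F^{\varepsilon}(x)=\{v:\langle F(y)-v,\,y-x\rangle\ge-\varepsilon\ \text{for all } y\in\mathcal H\}$, and let $P_D$ denote the orthogonal projection onto a nonempty closed convex set $D$. Let $x_0=x_{-1}\in\mathcal H$, $\sigma\in(0,1)$ and $\lambda=2\sigma^2/L$, and let the sequences $(x_k)$, $(y_k)$, $(v_k)$, $(\varepsilon_k)$ be generated, for $k=0,1,2,\dots$, by the inertial forward-backward algorithm $$w_k=x_k+\alpha_k(x_k-x_{k-1}),\qquad \widetilde w_k=w_k+\beta_k(w_k-x_0),\qquad w_k'=P_C(\widetilde w_k),$$ $$y_k=(\lambda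 B+I)^{-1}\big(\widetilde w_k-\lambda F(w_k')\big),\qquad v_k=\frac{\widetilde w_k-y_k}{\lambda},\qquad \varepsilon_k=\frac{\|y_k-w_k'\|^2}{4L^{-1}},$$ $$H_k=\{z:\langle z-y_k,v_k\rangle\le\varepsilon_k\},\qquad W_k=\{z:\langle z-x_k,x_0-x_k\rangle\le0\},\qquad x_{k+1}=P_{H_k\cap W_k}(x_0),$$ where $\alpha_k,\beta_k\ge0$ satisfy $\overline\alpha:=\sup_k\alpha_k<\infty$ and $\overline s:=\sum_{k=0}^\infty\beta_k^2<\infty$; put $\overline\beta:=\sup_k\beta_k$. Let $d_0$ be the distance from $x_0$ to $\mathcal S$. Then: (a) $(x_k)$ and $(y_k)$ converge strongly to $P_{\mathcal S}(x_0)$. (b) For every $k\ge0$ there is $j\in\{0,\dots,k\}$ such that $v_j\in(F^{\varepsilon_j}+B)(y_j)$, $$\|v_j\|\le\frac{2d_0L}{\sqrt{k+1}}\cdot\frac{\sqrt{(1+\overline\alpha)\left[(1+\overline\beta)\left(1+\overline\alpha(1+\overline\beta)\right)+\overline s\right]}}{2(1-\sigma^2)\sigma^2},$$ $$\varepsilon_j\le\frac{d_0^2L}{k+1}\cdot\frac{4\sigma^2(1+\overline\alpha)\left[(1+\overline\beta)\left(1+\overline\alpha(1+\overline\beta)\right)+\overline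 s\right]}{2(1-\sigma^2)^2\sigma^2}.$$ -/

import Mathlib

open Filter Topology
open scoped Pointwise

/- Set-valued maps on `H` are functions `H → Set H`. Their sum `T + S` and their scalar multiples
`c • T` are Mathlib's pointwise ones: `(T + S) x = {u + v | u ∈ T x, v ∈ S x}` and
`(c • T) x = {c • v | v ∈ T x}`. -/

namespace InertialFB

variable {H : Type*}

/-- A single-valued map, regarded as a set-valued one. -/
def single (F : H → H) : H → Set H := fun x => {F x}

/-- The inverse of a set-valued map: `x ∈ T⁻¹ v` if and only if `v ∈ T x`. -/
def inverse (T : H → Set H) : H → Set H := fun v => {x | v ∈ T x}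

/-- The effective domain of a set-valued map. -/
def dom (T : H → Set H) : Set H := {x | (T x).Nonempty}

variable [NormedAddCommGroup H] [InnerProductSpace ℝ H]

/-- The set of zeros `T⁻¹(0)`. -/
def zeros (T : H → Set H) : Set H := inverse T 0

/-- Monotone set-valued maps. -/
def IsMonotone (T : H → Set H) : Prop :=
  ∀ x y : H, ∀ u ∈ T x, ∀ v ∈ T y, 0 ≤ inner ℝ (x - y) (u - v)

/-- Maximal monotone set-valued maps: monotone, and the graph is not properly contained in the
graph of another monotone map. -/
def IsMaximalMonotone (T : H → Set H) : Prop :=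
  IsMonotone T ∧ ∀ T' : H → Set H, IsMonotone T' → (∀ x, T x ⊆ T' x) → T' = T

/-- The `ε`-enlargement of a set-valued map. -/
def enlargement (T : H → Set H) (ε : ℝ) : H → Set H := fun x =>
  {v | ∀ y : H, ∀ u ∈ T y, inner ℝ (u - v) (y - x) ≥ -ε}

/-- The resolvent `(c T + I)⁻¹`, as a set-valued map. -/
def resolventMap (c : ℝ) (T : H → Set H) : H → Set H := inverse (c • T + single id)

/-- `p` is a point of `C` nearest to `x`; if `C` is nonempty, closed and convex (in a Hilbert space)
there is exactly one such point, the orthogonal projection `P_C(x)`. -/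
def IsProj (C : Set H) (x p : H) : Prop :=
  p ∈ C ∧ ∀ z ∈ C, ‖x - p‖ ≤ ‖x - z‖

/-- `F` is defined on all of `H` and is `(1/L)`-cocoercive. -/
def IsCocoercive (F : H → H) (L : ℝ) : Prop :=
  ∀ x y : H, inner ℝ (x - y) (F x - F y) ≥ 1 / L * ‖F x - F y‖ ^ 2

/-- The half-space `{z | ⟨z - y, v⟩ ≤ ε}`. -/
def halfSpace (y v : H) (ε : ℝ) : Set H := {z | inner ℝ (z - y) v ≤ ε}

/-- The sequences are produced by the inertial forward-backward algorithm with starting point `x 0`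
and step size `lam`. -/
structure IsRun (F : H → H) (B : H → Set H) (C : Set H) (L lam : ℝ) (α β : ℕ → ℝ)
    (x w wt w' y v : ℕ → H) (ε : ℕ → ℝ) : Prop where
  alpha_nonneg : ∀ k, 0 ≤ α k
  beta_nonneg : ∀ k, 0 ≤ β k
  /- For `k = 0` the subtraction in `ℕ` truncates, so `x (0 - 1) = x 0`: this is the convention
  that the point `x_{-1}` equals `x_0`. -/
  w_eq : ∀ k, w k = x k + α k • (x k - x (k - 1))
  wt_eq : ∀ k, wt k = w k + β k • (w k - x 0)
  w'_proj : ∀ k, IsProj C (wt k) (w' k)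
  y_mem : ∀ k, y k ∈ resolventMap lam B (wt k - lam • F (w' k))
  v_eq : ∀ k, v k = (1 / lam) • (wt k - y k)
  ε_eq : ∀ k, ε k = ‖y k - w' k‖ ^ 2 / (4 * L⁻¹)
  x_succ : ∀ k, IsProj (halfSpace (y k) (v k) (ε k) ∩ halfSpace (x k) (x 0 - x k) 0)
    (x 0) (x (k + 1))

/-- The constant `(1 + a) [(1 + b) (1 + a (1 + b)) + s]` of the complexity bounds. -/
def boundConst (a b s : ℝ) : ℝ := (1 + a) * ((1 + b) * (1 + a * (1 + b)) + s)

end InertialFB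

/-!
A point `z` of the solution set satisfies `⟨z - y_k, v_k⟩ ≤ ε_k` because cocoercivity puts
`F(w'_k)` into the `ε_k`-enlargement of `F` at `y_k`. Hence `x_{k+1} = P_{H_k ∩ W_k}(x_0)` is a
Haugazeau iteration for half-spaces containing `S`: the distances `‖x_k - x_0‖` increase and are
bounded by `d(x_0, S)`, so `∑ ‖x_{k+1} - x_k‖² ≤ d(x_0, S)²`, and the inertial terms keep
`∑ ‖x_{k+1} - w̃_k‖²` of the same order. Since `w'_k` is a projection onto a set that contains
`y_k`, the error obeys `λ ε_k ≤ (λ L / 4) ‖w̃_k - y_k‖²`, so that `x_{k+1} ∈ H_k` gives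
`(1 - λ L / 4) ‖w̃_k - y_k‖ ≤ ‖x_{k+1} - w̃_k‖`. This yields the complexity bounds and makes all
residuals vanish in the limit. The maps `F` and `B` being demiclosed, weak cluster points of
`(x_k)` lie in `S`, and `‖x_k - x_0‖ ≤ d(x_0, S)` upgrades weak to strong convergence.
-/

namespace InertialFB

variable {H : Type*} [NormedAddCommGroup H] [InnerProductSpace ℝ H]

section Projection

variable {C : Set H} {x p q : H}

theorem isProj_iff_norm_eq_iInf {E : Type*} [NormedAddCommGroup E] {C : Set E} {x p : E} :
    IsProj C x p ↔ p ∈ C ∧ ‖x - p‖ = ⨅ z : C, ‖x - z‖ := by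
  have hbdd : BddBelow (Set.range fun z : C => ‖x - z‖) :=
    ⟨0, Set.forall_mem_range.2 fun _ => norm_nonneg _⟩
  refine and_congr_right fun hp => ⟨fun h => ?_, fun h z hz => h.trans_le (ciInf_le hbdd ⟨z, hz⟩)⟩
  have : Nonempty C := ⟨⟨p, hp⟩⟩
  exact le_antisymm (le_ciInf fun z => h z z.2) (ciInf_le hbdd ⟨p, hp⟩)

theorem IsProj.inner_le_zero (h : IsProj C x p) (hC : Convex ℝ C) {z : H} (hz : z ∈ C) :
    inner ℝ (x - p) (z - p) ≤ 0 :=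
  (norm_eq_iInf_iff_real_inner_le_zero hC h.1).1 (isProj_iff_norm_eq_iInf.1 h).2 z hz

theorem IsProj.norm_sub_le (h : IsProj C x p) (hC : Convex ℝ C) {z : H} (hz : z ∈ C) :
    ‖z - p‖ ≤ ‖z - x‖ := by
  have hexp : ‖z - x‖ ^ 2 = ‖z - p‖ ^ 2 - 2 * inner ℝ (x - p) (z - p) + ‖x - p‖ ^ 2 := by
    rw [← sub_sub_sub_cancel_right z x p, norm_sub_sq_real, real_inner_comm]
  refine le_of_sq_le_sq ?_ (norm_nonneg _)
  linarith [h.inner_le_zero hC hz, sq_nonneg ‖x - p‖]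

theorem IsProj.unique (hC : Convex ℝ C) (hp : IsProj C x p) (hq : IsProj C x q) : p = q := by
  have hsum : ‖q - p‖ ^ 2 = inner ℝ (x - p) (q - p) + inner ℝ (x - q) (p - q) := by
    rw [← neg_sub q p, inner_neg_right, ← sub_eq_add_neg, ← inner_sub_left,
      sub_sub_sub_cancel_left, real_inner_self_eq_norm_sq]
  have hle : ‖q - p‖ ^ 2 ≤ 0 := by
    linarith [hp.inner_le_zero hC hq.1, hq.inner_le_zero hC hp.1]
  exact (sub_eq_zero.1 (norm_eq_zero.1 (sq_nonpos_iff _ |>.1 hle))).symm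

theorem existsUnique_isProj [CompleteSpace H] (hne : C.Nonempty) (hcl : IsClosed C)
    (hC : Convex ℝ C) (x : H) : ∃! p, IsProj C x p := by
  obtain ⟨p, hp⟩ := exists_norm_eq_iInf_of_complete_convex hne hcl.isComplete hC x
  have hproj : IsProj C x p := isProj_iff_norm_eq_iInf.2 hp
  exact ⟨p, hproj, fun q hq => hq.unique hC hproj⟩

end Projection

theorem convex_halfSpace (y v : H) (ε : ℝ) : Convex ℝ (halfSpace y v ε) := by
  have h : halfSpace y v ε = {z | inner ℝ v z ≤ ε + inner ℝ v y} := by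
    ext z
    rw [halfSpace, Set.mem_ofPred_eq, real_inner_comm, inner_sub_right, sub_le_iff_le_add]
    rfl
  rw [h]
  exact convex_halfSpace_le (innerₛₗ ℝ v).isLinear _

theorem isClosed_halfSpace (y v : H) (ε : ℝ) : IsClosed (halfSpace y v ε) :=
  isClosed_le (by fun_prop) continuous_const

/-- Weak convergence of `x` to `a` along `l`, together with boundedness of `x` along `l`. For
sequences boundedness is automatic; along an arbitrary filter it has to be required. -/
structure BddWeakTendsto {ι : Type*} (x : ι → H) (l : Filter ι) (a : H) : Prop where
  isBoundedUnder : l.IsBoundedUnder (· ≤ ·) fun i => ‖x i‖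
  tendsto_inner_const : ∀ c, Tendsto (fun i => inner ℝ (x i) c) l (𝓝 (inner ℝ a c))

namespace BddWeakTendsto

variable {ι : Type*} {l : Filter ι} {x y : ι → H} {a : H}

theorem tendsto_inner (hx : BddWeakTendsto x l a) {c : ι → H} {c₀ : H} (hc : Tendsto c l (𝓝 c₀)) :
    Tendsto (fun i => inner ℝ (x i) (c i)) l (𝓝 (inner ℝ a c₀)) := by
  have hsub : Tendsto (fun i => inner ℝ (x i) (c i - c₀)) l (𝓝 0) :=
    (tendsto_sub_nhds_zero_iff.2 hc).op_zero_isBoundedUnder_le hx.isBoundedUnder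
      (fun c x => inner ℝ x c) fun c x => (norm_inner_le_norm x c).trans_eq (mul_comm _ _)
  simpa [inner_sub_right] using hsub.add (hx.tendsto_inner_const c₀)

theorem congr_of_tendsto_sub (hx : BddWeakTendsto x l a)
    (hyx : Tendsto (fun i => y i - x i) l (𝓝 0)) : BddWeakTendsto y l a where
  isBoundedUnder := by
    refine (isBoundedUnder_le_add hx.isBoundedUnder hyx.norm.isBoundedUnder_le).mono_le
      (Eventually.of_forall fun i => ?_)
    simpa using norm_add_le (x i) (y i - x i)
  tendsto_inner_const c := by
    simpa [inner_sub_left] using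
      (hx.tendsto_inner_const c).add (hyx.inner (tendsto_const_nhds (x := c)))

theorem mem_halfSpace [l.NeBot] (hx : BddWeakTendsto x l a) {u n₀ : H} {n : ι → H} {e : ι → ℝ}
    {e₀ : ℝ} (hn : Tendsto n l (𝓝 n₀)) (he : Tendsto e l (𝓝 e₀))
    (h : ∀ i, x i ∈ halfSpace u (n i) (e i)) : a ∈ halfSpace u n₀ e₀ := by
  have hlim : Tendsto (fun i => inner ℝ (x i - u) (n i)) l (𝓝 (inner ℝ (a - u) n₀)) := by
    simpa only [inner_sub_left] using
      (hx.tendsto_inner hn).sub ((tendsto_const_nhds (x := u)).inner hn)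
  exact le_of_tendsto_of_tendsto' hlim he h

end BddWeakTendsto

theorem exists_bddWeakTendsto [CompleteSpace H] {ι : Type*} {𝒰 : Ultrafilter ι} {x : ι → H}
    (hx : (𝒰 : Filter ι).IsBoundedUnder (· ≤ ·) fun i => ‖x i‖) :
    ∃ a, BddWeakTendsto x 𝒰 a := by
  obtain ⟨R, hR⟩ := hx.eventually_le
  let f : ι → WeakDual ℝ H := fun i =>
    StrongDual.toWeakDual (InnerProductSpace.toDual ℝ H (x i))
  obtain ⟨φ, -, hφ⟩ := (WeakDual.isCompact_closedBall (𝕜 := ℝ) (E := H) 0 R).ultrafilter_le_nhds'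
    (𝒰.map f) (hR.mono fun i hi => by simpa [f] using hi)
  refine ⟨(InnerProductSpace.toDual ℝ H).symm (WeakDual.toStrongDual φ), hx, fun c => ?_⟩
  rw [InnerProductSpace.toDual_symm_apply]
  exact ((WeakDual.eval_continuous (𝕜 := ℝ) (E := H) c).tendsto φ).comp hφ

theorem tendsto_of_bddWeakTendsto_of_norm_sub_le {ι : Type*} {l : Filter ι} {x : ι → H}
    {a p q : H} (hx : BddWeakTendsto x l a) (ha : inner ℝ (q - p) (a - p) ≤ 0)
    (hle : ∀ i, ‖x i - q‖ ≤ ‖q - p‖) : Tendsto x l (𝓝 p) := by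
  have hbound : ∀ i, ‖x i - p‖ ^ 2 ≤ 2 * (inner ℝ (x i) (q - p) - inner ℝ a (q - p)) := by
    intro i
    have hsq : ‖x i - q‖ ^ 2 ≤ ‖q - p‖ ^ 2 := by gcongr; exact hle i
    rw [← sub_sub_sub_cancel_right (x i) q p, norm_sub_sq_real] at hsq
    rw [real_inner_comm] at ha
    simp only [inner_sub_left _ p] at ha hsq
    linarith
  have hlim : Tendsto (fun i => 2 * (inner ℝ (x i) (q - p) - inner ℝ a (q - p))) l (𝓝 0) := by
    simpa using ((hx.tendsto_inner_const (q - p)).sub_const (inner ℝ a (q - p))).const_mul 2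
  rw [tendsto_iff_norm_sub_tendsto_zero]
  simpa using (squeeze_zero (fun _ => sq_nonneg _) hbound hlim).sqrt

theorem IsProj.tendsto_of_weak_cluster_mem [CompleteSpace H] {ι : Type*} {l : Filter ι}
    {x : ι → H} {S : Set H} {p q : H} (hp : IsProj S q p) (hS : Convex ℝ S)
    (hle : ∀ i, ‖x i - q‖ ≤ ‖q - p‖)
    (hcluster : ∀ (𝒰 : Ultrafilter ι) (a : H), ↑𝒰 ≤ l → BddWeakTendsto x 𝒰 a → a ∈ S) :
    Tendsto x l (𝓝 p) := by
  refine tendsto_iff_ultrafilter _ _ _ |>.2 fun 𝒰 h𝒰 => ?_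
  have hbdd : (𝒰 : Filter ι).IsBoundedUnder (· ≤ ·) fun i => ‖x i‖ := by
    refine isBoundedUnder_of ⟨‖q - p‖ + ‖q‖, fun i => ?_⟩
    simpa using (norm_add_le (x i - q) q).trans (add_le_add_left (hle i) ‖q‖)
  obtain ⟨a, ha⟩ := exists_bddWeakTendsto hbdd
  exact tendsto_of_bddWeakTendsto_of_norm_sub_le ha
    (hp.inner_le_zero hS (hcluster 𝒰 a h𝒰 ha)) hle

section MonotoneOperators

variable {F : H → H} {B : H → Set H} {L : ℝ}

theorem mem_zeros_iff {E : Type*} [NormedAddCommGroup E] {F : E → E} {B : E → Set E} {z : E} :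
    z ∈ zeros (single F + B) ↔ -F z ∈ B z := by
  change (0 : E) ∈ {F z} + B z ↔ _
  rw [Set.singleton_add, Set.mem_image]
  exact ⟨fun ⟨b, hb, h⟩ => eq_neg_of_add_eq_zero_right h ▸ hb, fun h => ⟨_, h, add_neg_cancel _⟩⟩

theorem IsMaximalMonotone.inverse_eq_iInter (hB : IsMaximalMonotone B) (c : H) :
    inverse B c = ⋂ (u) (b ∈ B u), halfSpace u (b - c) 0 := by
  have hmem : ∀ z u b, z ∈ halfSpace u (b - c) 0 ↔ 0 ≤ inner ℝ (u - z) (b - c) := by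
    intro z u b
    rw [← neg_sub z u, inner_neg_left, neg_nonneg]
    rfl
  ext z
  simp only [Set.mem_iInter, hmem]
  refine ⟨fun hz u b hb => hB.1 u z b hb c hz, fun h => ?_⟩
  have hext := hB.2 (fun x => B x ∪ {v | x = z ∧ v = c}) ?_ fun x => Set.subset_union_left
  · change c ∈ B z
    exact hext ▸ Or.inr ⟨rfl, rfl⟩
  · rintro x y u (hu | ⟨rfl, rfl⟩) v (hv | ⟨rfl, rfl⟩)
    · exact hB.1 x y u hu v hv
    · exact h x u hu
    · rw [← neg_sub y, ← neg_sub v, inner_neg_neg]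
      exact h y v hv
    · simp

theorem IsMaximalMonotone.mem_of_bddWeakTendsto {ι : Type*} {l : Filter ι} [l.NeBot]
    {y b : ι → H} {a c : H} (hB : IsMaximalMonotone B) (hy : BddWeakTendsto y l a)
    (hb : Tendsto b l (𝓝 c)) (hmem : ∀ i, b i ∈ B (y i)) : c ∈ B a := by
  change a ∈ inverse B c
  rw [hB.inverse_eq_iInter]
  refine Set.mem_iInter₂.2 fun u d => Set.mem_iInter.2 fun hd => ?_
  refine hy.mem_halfSpace (hb.const_sub d) tendsto_const_nhds fun i => ?_
  have hi : y i ∈ inverse B (b i) := hmem i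
  rw [hB.inverse_eq_iInter] at hi
  exact Set.mem_iInter.1 (Set.mem_iInter₂.1 hi u d) hd

theorem IsCocoercive.norm_sub_le (hF : IsCocoercive F L) (hL : 0 < L) (x y : H) :
    ‖F x - F y‖ ≤ L * ‖x - y‖ := by
  rcases (norm_nonneg (F x - F y)).eq_or_lt with h0 | hpos
  · rw [← h0]
    positivity
  · refine le_of_mul_le_mul_right ?_ hpos
    calc ‖F x - F y‖ * ‖F x - F y‖ = L * (1 / L * ‖F x - F y‖ ^ 2) := by field_simp
      _ ≤ L * (‖x - y‖ * ‖F x - F y‖) :=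
        mul_le_mul_of_nonneg_left ((hF x y).le.trans (real_inner_le_norm _ _)) hL.le
      _ = L * ‖x - y‖ * ‖F x - F y‖ := by ring

theorem IsCocoercive.mem_enlargement (hF : IsCocoercive F L) (hL : 0 < L) (y z : H) :
    F z ∈ enlargement (single F) (‖y - z‖ ^ 2 / (4 * L⁻¹)) y := by
  rintro q _ rfl
  have hsplit : inner ℝ (F q - F z) (q - y) =
      inner ℝ (q - z) (F q - F z) - inner ℝ (F q - F z) (y - z) := by
    rw [real_inner_comm (F q - F z) (q - z), ← inner_sub_right, sub_sub_sub_cancel_right]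
  have hamgm : ‖F q - F z‖ * ‖y - z‖ ≤
      1 / L * ‖F q - F z‖ ^ 2 + ‖y - z‖ ^ 2 / (4 * L⁻¹) := by
    have hsq : 0 ≤ 1 / L * (‖F q - F z‖ - L * ‖y - z‖ / 2) ^ 2 := by positivity
    have hexp : 1 / L * (‖F q - F z‖ - L * ‖y - z‖ / 2) ^ 2 =
        1 / L * ‖F q - F z‖ ^ 2 + ‖y - z‖ ^ 2 / (4 * L⁻¹) - ‖F q - F z‖ * ‖y - z‖ := by
      field_simp
      ring
    linarith
  linarith [hF q z, real_inner_le_norm (F q - F z) (y - z)]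

theorem IsCocoercive.preimage_singleton_eq_iInter (hF : IsCocoercive F L) (hL : 0 < L) (c : H) :
    F ⁻¹' {c} = ⋂ u, halfSpace u (F u - c) (-(1 / L * ‖F u - c‖ ^ 2)) := by
  have hmem : ∀ z u, z ∈ halfSpace u (F u - c) (-(1 / L * ‖F u - c‖ ^ 2)) ↔
      1 / L * ‖F u - c‖ ^ 2 ≤ inner ℝ (u - z) (F u - c) := by
    intro z u
    rw [← neg_sub z u, inner_neg_left, le_neg]
    rfl
  ext z
  simp only [Set.mem_iInter, hmem, Set.mem_preimage, Set.mem_singleton_iff]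
  refine ⟨?_, fun h => ?_⟩
  · rintro rfl u
    exact hF u z
  · have hz : 1 / L * ‖F z - c‖ ^ 2 ≤ 0 := by simpa using h z
    have hsq : ‖F z - c‖ ^ 2 ≤ 0 := nonpos_of_mul_nonpos_right hz (by positivity)
    exact sub_eq_zero.1 (norm_eq_zero.1 ((sq_nonpos_iff _).1 hsq))

theorem IsCocoercive.eq_of_bddWeakTendsto {ι : Type*} {l : Filter ι} [l.NeBot] {y : ι → H}
    {a c : H} (hF : IsCocoercive F L) (hL : 0 < L) (hy : BddWeakTendsto y l a)
    (hFy : Tendsto (fun i => F (y i)) l (𝓝 c)) : F a = c := by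
  change a ∈ F ⁻¹' {c}
  rw [hF.preimage_singleton_eq_iInter hL]
  refine Set.mem_iInter.2 fun u => ?_
  have hn : Tendsto (fun i => F u - F (y i)) l (𝓝 (F u - c)) := hFy.const_sub (F u)
  refine hy.mem_halfSpace hn ((hn.norm.pow 2).const_mul (1 / L)).neg fun i => ?_
  have hi : y i ∈ F ⁻¹' {F (y i)} := rfl
  rw [hF.preimage_singleton_eq_iInter hL] at hi
  exact Set.mem_iInter.1 hi u

theorem IsCocoercive.eq_of_inner_nonpos (hF : IsCocoercive F L) (hL : 0 < L) {x y : H}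
    (h : inner ℝ (x - y) (F x - F y) ≤ 0) : F x = F y := by
  have hsq : ‖F x - F y‖ ^ 2 ≤ 0 :=
    nonpos_of_mul_nonpos_right ((hF x y).le.trans h) (by positivity)
  exact sub_eq_zero.1 (norm_eq_zero.1 ((sq_nonpos_iff _).1 hsq))

theorem zeros_eq_inter (hF : IsCocoercive F L) (hL : 0 < L) (hB : IsMonotone B) {z₀ : H}
    (hz₀ : z₀ ∈ zeros (single F + B)) :
    zeros (single F + B) = F ⁻¹' {F z₀} ∩ inverse B (-F z₀) := by
  ext z
  refine ⟨fun hz => ?_, fun ⟨hFz, hBz⟩ => mem_zeros_iff.2 (hFz ▸ hBz)⟩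
  rw [mem_zeros_iff] at hz hz₀
  have hFz : F z = F z₀ := hF.eq_of_inner_nonpos hL <| by
    have hmono := hB z z₀ _ hz _ hz₀
    rwa [neg_sub_neg, ← neg_sub (F z), inner_neg_right, neg_nonneg] at hmono
  exact ⟨hFz, hFz ▸ hz⟩

theorem convex_zeros (hF : IsCocoercive F L) (hL : 0 < L) (hB : IsMaximalMonotone B) :
    Convex ℝ (zeros (single F + B)) := by
  rcases (zeros (single F + B)).eq_empty_or_nonempty with hempty | ⟨z₀, hz₀⟩
  · rw [hempty]
    exact convex_empty
  · rw [zeros_eq_inter hF hL hB.1 hz₀, hF.preimage_singleton_eq_iInter hL, hB.inverse_eq_iInter]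
    exact (convex_iInter fun _ => convex_halfSpace _ _ _).inter
      (convex_iInter₂ fun _ _ => convex_iInter fun _ => convex_halfSpace _ _ _)

theorem isClosed_zeros (hF : IsCocoercive F L) (hL : 0 < L) (hB : IsMaximalMonotone B) :
    IsClosed (zeros (single F + B)) := by
  rcases (zeros (single F + B)).eq_empty_or_nonempty with hempty | ⟨z₀, hz₀⟩
  · rw [hempty]
    exact isClosed_empty
  · rw [zeros_eq_inter hF hL hB.1 hz₀, hF.preimage_singleton_eq_iInter hL, hB.inverse_eq_iInter]
    exact (isClosed_iInter fun _ => isClosed_halfSpace _ _ _).inter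
      (isClosed_iInter fun _ => isClosed_iInter fun _ => isClosed_iInter fun _ =>
        isClosed_halfSpace _ _ _)

theorem tendsto_apply_of_residual_tendsto_zero {ι : Type*} {l : Filter ι} {y b : ι → H} {z : H}
    (hF : IsCocoercive F L) (hL : 0 < L) (hB : IsMonotone B) (hz : z ∈ zeros (single F + B))
    (hy : l.IsBoundedUnder (· ≤ ·) fun i => ‖y i‖) (hb : ∀ i, b i ∈ B (y i))
    (hr : Tendsto (fun i => F (y i) + b i) l (𝓝 0)) :
    Tendsto (fun i => F (y i)) l (𝓝 (F z)) := by
  have hbound : ∀ i, ‖F (y i) - F z‖ ^ 2 ≤ L * inner ℝ (F (y i) + b i) (y i - z) := by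
    intro i
    have hmono := hB (y i) z _ (hb i) _ (mem_zeros_iff.1 hz)
    have hsplit : inner ℝ (F (y i) + b i) (y i - z) =
        inner ℝ (y i - z) (F (y i) - F z) + inner ℝ (y i - z) (b i - -F z) := by
      rw [← inner_add_right, real_inner_comm]
      congr 1
      abel
    calc ‖F (y i) - F z‖ ^ 2 = L * (1 / L * ‖F (y i) - F z‖ ^ 2) := by field_simp
      _ ≤ L * inner ℝ (F (y i) + b i) (y i - z) :=
        mul_le_mul_of_nonneg_left (by linarith [hF (y i) z]) hL.le
  have hyz : l.IsBoundedUnder (· ≤ ·) fun i => ‖y i - z‖ :=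
    (isBoundedUnder_le_add hy (isBoundedUnder_const (a := ‖z‖))).mono_le
      (Eventually.of_forall fun i => norm_sub_le (y i) z)
  have hlim : Tendsto (fun i => L * inner ℝ (F (y i) + b i) (y i - z)) l (𝓝 0) := by
    simpa using (hr.op_zero_isBoundedUnder_le hyz (inner ℝ) norm_inner_le_norm).const_mul L
  rw [tendsto_iff_norm_sub_tendsto_zero]
  simpa using (squeeze_zero (fun _ => sq_nonneg _) hbound hlim).sqrt

theorem mem_zeros_of_bddWeakTendsto {ι : Type*} {l : Filter ι} [l.NeBot] {y b : ι → H} {a : H}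
    (hF : IsCocoercive F L) (hL : 0 < L) (hB : IsMaximalMonotone B)
    (hne : (zeros (single F + B)).Nonempty) (hy : BddWeakTendsto y l a)
    (hb : ∀ i, b i ∈ B (y i)) (hr : Tendsto (fun i => F (y i) + b i) l (𝓝 0)) :
    a ∈ zeros (single F + B) := by
  obtain ⟨z, hz⟩ := hne
  have hFy : Tendsto (fun i => F (y i)) l (𝓝 (F z)) :=
    tendsto_apply_of_residual_tendsto_zero hF hL hB.1 hz hy.isBoundedUnder hb hr
  have hbz : Tendsto b l (𝓝 (-F z)) := by simpa using hr.sub hFy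
  rw [mem_zeros_iff, hF.eq_of_bddWeakTendsto hL hy hFy]
  exact hB.mem_of_bddWeakTendsto hy hbz hb

end MonotoneOperators

/-- Haugazeau's iteration for a sequence of sets `D k`: each `x (k + 1)` is the projection of the
starting point onto `D k ∩ W k`, where `W k = {z | ⟨z - x k, x 0 - x k⟩ ≤ 0}`. -/
def IsHaugazeau (D : ℕ → Set H) (x : ℕ → H) : Prop :=
  ∀ k, IsProj (D k ∩ halfSpace (x k) (x 0 - x k) 0) (x 0) (x (k + 1))

theorem sq_norm_sub_smul_add_smul_le (p q u : H) {c : ℝ} (hc : 0 ≤ c) (b : ℝ) :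
    ‖p - (c • q + b • u)‖ ^ 2 ≤
      2 * ((1 + c) * (‖p‖ ^ 2 + c * ‖q‖ ^ 2) + b ^ 2 * ‖u‖ ^ 2) := by
  have hpq : ‖p - c • q‖ ^ 2 ≤ (1 + c) * (‖p‖ ^ 2 + c * ‖q‖ ^ 2) := by
    have hcross : 0 ≤ c * ‖p + q‖ ^ 2 := by positivity
    rw [norm_add_sq_real] at hcross
    rw [norm_sub_sq_real, real_inner_smul_right, norm_smul, Real.norm_of_nonneg hc]
    linarith
  have hpar : ‖p - c • q - b • u‖ ^ 2 ≤ 2 * (‖p - c • q‖ ^ 2 + ‖b • u‖ ^ 2) := by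
    have hlaw := parallelogram_law_with_norm ℝ (p - c • q) (b • u)
    linarith [sq_nonneg ‖p - c • q + b • u‖]
  have hbu : ‖b • u‖ ^ 2 = b ^ 2 * ‖u‖ ^ 2 := by
    rw [norm_smul, mul_pow, Real.norm_eq_abs, sq_abs]
  rw [← sub_sub]
  linarith

namespace IsHaugazeau

variable {D : ℕ → Set H} {x : ℕ → H} {z : H}

theorem mem_halfSpace (h : IsHaugazeau D x) (hD : ∀ k, Convex ℝ (D k)) (hz : ∀ k, z ∈ D k)
    (k : ℕ) : z ∈ halfSpace (x k) (x 0 - x k) 0 := by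
  induction k with
  | zero => simp [halfSpace]
  | succ k ih =>
    have hproj := (h k).inner_le_zero ((hD k).inter (convex_halfSpace _ _ _)) ⟨hz k, ih⟩
    rwa [real_inner_comm] at hproj

theorem norm_sub_start_le (h : IsHaugazeau D x) (hD : ∀ k, Convex ℝ (D k)) (hz : ∀ k, z ∈ D k)
    (k : ℕ) : ‖x k - x 0‖ ≤ ‖x 0 - z‖ := by
  cases k with
  | zero => simp
  | succ k =>
    rw [norm_sub_rev]
    exact (h k).2 z ⟨hz k, h.mem_halfSpace hD hz k⟩

theorem sq_norm_succ_sub_le (h : IsHaugazeau D x) (k : ℕ) :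
    ‖x (k + 1) - x k‖ ^ 2 ≤ ‖x (k + 1) - x 0‖ ^ 2 - ‖x k - x 0‖ ^ 2 := by
  have hW : inner ℝ (x (k + 1) - x k) (x 0 - x k) ≤ 0 := (h k).1.2
  have hexp := norm_sub_sq_real (x (k + 1) - x k) (x 0 - x k)
  rw [sub_sub_sub_cancel_right, norm_sub_rev (x 0)] at hexp
  linarith

theorem sum_sq_norm_succ_sub_le (h : IsHaugazeau D x) (hD : ∀ k, Convex ℝ (D k))
    (hz : ∀ k, z ∈ D k) (n : ℕ) :
    ∑ k ∈ Finset.range n, ‖x (k + 1) - x k‖ ^ 2 ≤ ‖x 0 - z‖ ^ 2 := by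
  calc ∑ k ∈ Finset.range n, ‖x (k + 1) - x k‖ ^ 2
      ≤ ∑ k ∈ Finset.range n, (‖x (k + 1) - x 0‖ ^ 2 - ‖x k - x 0‖ ^ 2) :=
        Finset.sum_le_sum fun k _ => h.sq_norm_succ_sub_le k
    _ = ‖x n - x 0‖ ^ 2 := by
        rw [Finset.sum_range_sub (fun k => ‖x k - x 0‖ ^ 2)]
        simp
    _ ≤ ‖x 0 - z‖ ^ 2 := by
        gcongr
        exact h.norm_sub_start_le hD hz n

theorem sum_sq_norm_sub_pred_le (h : IsHaugazeau D x) (hD : ∀ k, Convex ℝ (D k))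
    (hz : ∀ k, z ∈ D k) (n : ℕ) :
    ∑ k ∈ Finset.range n, ‖x k - x (k - 1)‖ ^ 2 ≤ ‖x 0 - z‖ ^ 2 := by
  cases n with
  | zero => simp
  | succ n =>
    rw [Finset.sum_range_succ']
    simpa using h.sum_sq_norm_succ_sub_le hD hz n

theorem tendsto_succ_sub (h : IsHaugazeau D x) (hD : ∀ k, Convex ℝ (D k)) (hz : ∀ k, z ∈ D k) :
    Tendsto (fun k => x (k + 1) - x k) atTop (𝓝 0) := by
  have hsum := summable_of_sum_range_le (fun _ => sq_nonneg _) (h.sum_sq_norm_succ_sub_le hD hz)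
  rw [tendsto_zero_iff_norm_tendsto_zero]
  simpa using hsum.tendsto_atTop_zero.sqrt

theorem sum_sq_norm_sub_extrapolation_le (h : IsHaugazeau D x) (hD : ∀ k, Convex ℝ (D k))
    (hz : ∀ k, z ∈ D k) {γ β : ℕ → ℝ} {c : ℝ} (hγ0 : ∀ k, 0 ≤ γ k) (hγc : ∀ k, γ k ≤ c)
    (hβ : Summable fun k => β k ^ 2) (n : ℕ) :
    ∑ k ∈ Finset.range n,
        ‖x (k + 1) - (x k + γ k • (x k - x (k - 1)) + β k • (x k - x 0))‖ ^ 2 ≤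
      2 * ((1 + c) ^ 2 + ∑' i, β i ^ 2) * ‖x 0 - z‖ ^ 2 := by
  have hc : 0 ≤ c := (hγ0 0).trans (hγc 0)
  set d := ‖x 0 - z‖ ^ 2 with hd
  have hterm : ∀ k, ‖x (k + 1) - (x k + γ k • (x k - x (k - 1)) + β k • (x k - x 0))‖ ^ 2 ≤
      2 * ((1 + c) * (‖x (k + 1) - x k‖ ^ 2 + c * ‖x k - x (k - 1)‖ ^ 2) + β k ^ 2 * d) := by
    intro k
    have hγk0 := hγ0 k
    have hγk := hγc k
    have hdist := h.norm_sub_start_le hD hz k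
    rw [add_assoc, ← sub_sub]
    refine (sq_norm_sub_smul_add_smul_le _ _ _ hγk0 _).trans ?_
    rw [hd]
    gcongr
  calc _ ≤ ∑ k ∈ Finset.range n, 2 * ((1 + c) *
          (‖x (k + 1) - x k‖ ^ 2 + c * ‖x k - x (k - 1)‖ ^ 2) + β k ^ 2 * d) :=
        Finset.sum_le_sum fun k _ => hterm k
    _ = 2 * ((1 + c) * (∑ k ∈ Finset.range n, ‖x (k + 1) - x k‖ ^ 2 +
          c * ∑ k ∈ Finset.range n, ‖x k - x (k - 1)‖ ^ 2) +
          (∑ k ∈ Finset.range n, β k ^ 2) * d) := by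
        simp only [← Finset.mul_sum, Finset.sum_add_distrib, Finset.sum_mul]
    _ ≤ 2 * ((1 + c) * (d + c * d) + (∑' i, β i ^ 2) * d) := by
        gcongr
        · exact h.sum_sq_norm_succ_sub_le hD hz n
        · exact h.sum_sq_norm_sub_pred_le hD hz n
        · exact hβ.sum_le_tsum _ fun _ _ => sq_nonneg _
    _ = 2 * ((1 + c) ^ 2 + ∑' i, β i ^ 2) * d := by ring

end IsHaugazeau

theorem one_sub_mul_norm_sub_le {x y w : H} {τ : ℝ}
    (h : inner ℝ (x - y) (w - y) ≤ τ * ‖w - y‖ ^ 2) : (1 - τ) * ‖w - y‖ ≤ ‖x - w‖ := by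
  have hsplit : inner ℝ (x - y) (w - y) = inner ℝ (x - w) (w - y) + ‖w - y‖ ^ 2 := by
    rw [← real_inner_self_eq_norm_sq, ← inner_add_left, sub_add_sub_cancel]
  have hcs := neg_le_of_abs_le (abs_real_inner_le_norm (x - w) (w - y))
  rcases (norm_nonneg (w - y)).eq_or_lt with h0 | hpos
  · rw [← h0, mul_zero]
    exact norm_nonneg _
  · refine le_of_mul_le_mul_right ?_ hpos
    linarith

theorem bddAbove_range_of_summable_sq {β : ℕ → ℝ} (hβ : Summable fun k => β k ^ 2) :
    BddAbove (Set.range β) := by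
  refine ⟨√(∑' i, β i ^ 2), Set.forall_mem_range.2 fun k => ?_⟩
  exact Real.le_sqrt_of_sq_le (hβ.le_tsum k fun _ _ => sq_nonneg _)

theorem sq_add_le_boundConst {a b s : ℝ} (ha : 0 ≤ a) (hb : 0 ≤ b) (hs : 0 ≤ s) :
    (1 + (1 + b) * a) ^ 2 + s ≤ boundConst a b s := by
  have hdiff : boundConst a b s - ((1 + (1 + b) * a) ^ 2 + s) =
      b * (1 + (1 + b) * a) + a * s := by
    unfold boundConst
    ring
  have hnonneg : 0 ≤ b * (1 + (1 + b) * a) + a * s := by positivity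
  linarith

theorem boundConst_nonneg {a b s : ℝ} (ha : 0 ≤ a) (hb : 0 ≤ b) (hs : 0 ≤ s) :
    0 ≤ boundConst a b s := by
  unfold boundConst
  positivity

theorem exists_card_mul_le_sum (f : ℕ → ℝ) (k : ℕ) :
    ∃ j ≤ k, ((k : ℝ) + 1) * f j ≤ ∑ i ∈ Finset.range (k + 1), f i := by
  have havg : ∑ i ∈ Finset.range (k + 1), f i ≤
      ∑ _i ∈ Finset.range (k + 1), (∑ i ∈ Finset.range (k + 1), f i) / ((k : ℝ) + 1) := by
    rw [Finset.sum_const, Finset.card_range, nsmul_eq_mul, Nat.cast_succ,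
      mul_div_cancel₀ _ (by positivity)]
  obtain ⟨j, hj, hle⟩ := Finset.exists_le_of_sum_le ⟨0, by simp⟩ havg
  refine ⟨j, Nat.lt_succ_iff.1 (Finset.mem_range.1 hj), ?_⟩
  rwa [le_div_iff₀' (by positivity)] at hle

theorem le_mul_infDist {E : Type*} [PseudoMetricSpace E] {S : Set E} {x : E} {r M : ℝ}
    (hS : S.Nonempty) (hM : 0 ≤ M) (h : ∀ z ∈ S, r ≤ M * dist x z) :
    r ≤ M * Metric.infDist x S := by
  have : Nonempty S := hS.to_subtype
  rw [Metric.infDist_eq_iInf, Real.mul_iInf_of_nonneg hM]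
  exact le_ciInf fun z => h z z.2

namespace IsRun

variable {F : H → H} {B : H → Set H} {C : Set H} {L lam : ℝ} {α β : ℕ → ℝ}
  {x w wt w' y v : ℕ → H} {ε : ℕ → ℝ} {z : H}

theorem isHaugazeau (h : IsRun F B C L lam α β x w wt w' y v ε) :
    IsHaugazeau (fun k => halfSpace (y k) (v k) (ε k)) x :=
  h.x_succ

theorem wt_eq_extrapolation (h : IsRun F B C L lam α β x w wt w' y v ε) (k : ℕ) :
    wt k = x k + ((1 + β k) * α k) • (x k - x (k - 1)) + β k • (x k - x 0) := by
  rw [h.wt_eq, h.w_eq]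
  module

theorem norm_v_eq (h : IsRun F B C L lam α β x w wt w' y v ε) (hlam : 0 < lam) (k : ℕ) :
    ‖v k‖ = lam⁻¹ * ‖wt k - y k‖ := by
  rw [h.v_eq, norm_smul, one_div, Real.norm_of_nonneg (by positivity)]

theorem sub_mem (h : IsRun F B C L lam α β x w wt w' y v ε) (hlam : lam ≠ 0) (k : ℕ) :
    v k - F (w' k) ∈ B (y k) := by
  have hy : wt k - lam • F (w' k) ∈ lam • B (y k) + {y k} := h.y_mem k
  rw [Set.add_singleton] at hy
  obtain ⟨_, ⟨b, hb, rfl⟩, hby : lam • b + y k = wt k - lam • F (w' k)⟩ := hy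
  have hwy : wt k - y k = lam • (F (w' k) + b) := by
    rw [smul_add, sub_eq_iff_eq_add, add_assoc, hby, add_sub_cancel]
  rwa [h.v_eq, hwy, smul_smul, one_div_mul_cancel hlam, one_smul, add_sub_cancel_left]

theorem mem_enlargement_add (h : IsRun F B C L lam α β x w wt w' y v ε) (hlam : lam ≠ 0)
    (hL : 0 < L) (hF : IsCocoercive F L) (k : ℕ) :
    v k ∈ (enlargement (single F) (ε k) + B) (y k) := by
  rw [h.ε_eq, ← add_sub_cancel (F (w' k)) (v k)]
  exact Set.add_mem_add (hF.mem_enlargement hL _ _) (h.sub_mem hlam k)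

theorem mem_halfSpace (h : IsRun F B C L lam α β x w wt w' y v ε) (hlam : lam ≠ 0)
    (hL : 0 < L) (hF : IsCocoercive F L) (hB : IsMonotone B) (hz : z ∈ zeros (single F + B))
    (k : ℕ) : z ∈ halfSpace (y k) (v k) (ε k) := by
  have henl := hF.mem_enlargement hL (y k) (w' k) z (F z) rfl
  have hmono := hB z (y k) _ (mem_zeros_iff.1 hz) _ (h.sub_mem hlam k)
  have hsplit : inner ℝ (z - y k) (v k) =
      -inner ℝ (F z - F (w' k)) (z - y k) - inner ℝ (z - y k) (-F z - (v k - F (w' k))) := by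
    rw [real_inner_comm (z - y k) (F z - F (w' k)), ← inner_neg_right, ← inner_sub_right]
    congr 1
    abel
  change inner ℝ (z - y k) (v k) ≤ ε k
  rw [← h.ε_eq] at henl
  linarith

theorem norm_y_sub_w'_le (h : IsRun F B C L lam α β x w wt w' y v ε) (hlam : lam ≠ 0)
    (hC : Convex ℝ C) (hBC : dom B ⊆ C) (k : ℕ) : ‖y k - w' k‖ ≤ ‖wt k - y k‖ := by
  rw [norm_sub_rev (wt k)]
  exact (h.w'_proj k).norm_sub_le hC (hBC ⟨_, h.sub_mem hlam k⟩)

theorem ε_le (h : IsRun F B C L lam α β x w wt w' y v ε) (hlam : lam ≠ 0) (hL : 0 < L)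
    (hC : Convex ℝ C) (hBC : dom B ⊆ C) (k : ℕ) : ε k ≤ L / 4 * ‖wt k - y k‖ ^ 2 := by
  calc ε k = L / 4 * ‖y k - w' k‖ ^ 2 := by rw [h.ε_eq]; field_simp
    _ ≤ L / 4 * ‖wt k - y k‖ ^ 2 := by
      gcongr
      exact h.norm_y_sub_w'_le hlam hC hBC k

theorem norm_wt_sub_y_le (h : IsRun F B C L lam α β x w wt w' y v ε) (hlam : 0 < lam)
    (hL : 0 < L) (hC : Convex ℝ C) (hBC : dom B ⊆ C) (k : ℕ) :
    (1 - lam * L / 4) * ‖wt k - y k‖ ≤ ‖x (k + 1) - wt k‖ := by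
  refine one_sub_mul_norm_sub_le ?_
  have hmem : inner ℝ (x (k + 1) - y k) (v k) ≤ ε k := (h.x_succ k).1.1
  calc inner ℝ (x (k + 1) - y k) (wt k - y k) = lam * inner ℝ (x (k + 1) - y k) (v k) := by
        rw [h.v_eq, real_inner_smul_right, ← mul_assoc, mul_one_div_cancel hlam.ne', one_mul]
    _ ≤ lam * (L / 4 * ‖wt k - y k‖ ^ 2) :=
        mul_le_mul_of_nonneg_left (hmem.trans (h.ε_le hlam.ne' hL hC hBC k)) hlam.le
    _ = lam * L / 4 * ‖wt k - y k‖ ^ 2 := by ring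

theorem boundConst_nonneg (h : IsRun F B C L lam α β x w wt w' y v ε) :
    0 ≤ boundConst (⨆ i, α i) (⨆ i, β i) (∑' i, β i ^ 2) :=
  InertialFB.boundConst_nonneg (Real.iSup_nonneg h.alpha_nonneg)
    (Real.iSup_nonneg h.beta_nonneg) (tsum_nonneg fun _ => sq_nonneg _)

theorem sum_sq_norm_sub_wt_le (h : IsRun F B C L lam α β x w wt w' y v ε)
    (hz : ∀ k, z ∈ halfSpace (y k) (v k) (ε k)) (hα : BddAbove (Set.range α))
    (hβ : Summable fun k => β k ^ 2) (n : ℕ) :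
    ∑ k ∈ Finset.range n, ‖x (k + 1) - wt k‖ ^ 2 ≤
      2 * boundConst (⨆ i, α i) (⨆ i, β i) (∑' i, β i ^ 2) * ‖x 0 - z‖ ^ 2 := by
  have ha : 0 ≤ ⨆ i, α i := Real.iSup_nonneg h.alpha_nonneg
  have hb : 0 ≤ ⨆ i, β i := Real.iSup_nonneg h.beta_nonneg
  have hs : 0 ≤ ∑' i, β i ^ 2 := tsum_nonneg fun _ => sq_nonneg _
  have hγ0 : ∀ k, 0 ≤ (1 + β k) * α k := fun k =>
    mul_nonneg (add_nonneg zero_le_one (h.beta_nonneg k)) (h.alpha_nonneg k)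
  have hγc : ∀ k, (1 + β k) * α k ≤ (1 + ⨆ i, β i) * ⨆ i, α i := fun k =>
    mul_le_mul (add_le_add_right (le_ciSup (bddAbove_range_of_summable_sq hβ) k) 1)
      (le_ciSup hα k) (h.alpha_nonneg k) (by positivity)
  have hsum := h.isHaugazeau.sum_sq_norm_sub_extrapolation_le
    (fun _ => convex_halfSpace _ _ _) hz hγ0 hγc hβ n
  simp only [← h.wt_eq_extrapolation] at hsum
  refine hsum.trans ?_
  gcongr
  exact sq_add_le_boundConst ha hb hs

theorem tendsto_succ_sub_wt (h : IsRun F B C L lam α β x w wt w' y v ε)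
    (hz : ∀ k, z ∈ halfSpace (y k) (v k) (ε k)) (hα : BddAbove (Set.range α))
    (hβ : Summable fun k => β k ^ 2) : Tendsto (fun k => x (k + 1) - wt k) atTop (𝓝 0) := by
  have hsum := summable_of_sum_range_le (fun _ => sq_nonneg _)
    (h.sum_sq_norm_sub_wt_le hz hα hβ)
  rw [tendsto_zero_iff_norm_tendsto_zero]
  simpa using hsum.tendsto_atTop_zero.sqrt

theorem tendsto_wt_sub_y (h : IsRun F B C L lam α β x w wt w' y v ε) (hlam : 0 < lam)
    (hL : 0 < L) (hlamL : lam * L < 4) (hC : Convex ℝ C) (hBC : dom B ⊆ C)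
    (hz : ∀ k, z ∈ halfSpace (y k) (v k) (ε k)) (hα : BddAbove (Set.range α))
    (hβ : Summable fun k => β k ^ 2) : Tendsto (fun k => wt k - y k) atTop (𝓝 0) := by
  have hgap : 0 < 1 - lam * L / 4 := by linarith
  have hlim := (h.tendsto_succ_sub_wt hz hα hβ).norm.div_const (1 - lam * L / 4)
  rw [norm_zero, zero_div] at hlim
  refine squeeze_zero_norm (fun k => ?_) hlim
  rw [le_div_iff₀' hgap]
  exact h.norm_wt_sub_y_le hlam hL hC hBC k

theorem tendsto_y_sub_x (h : IsRun F B C L lam α β x w wt w' y v ε) (hlam : 0 < lam)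
    (hL : 0 < L) (hlamL : lam * L < 4) (hC : Convex ℝ C) (hBC : dom B ⊆ C)
    (hz : ∀ k, z ∈ halfSpace (y k) (v k) (ε k)) (hα : BddAbove (Set.range α))
    (hβ : Summable fun k => β k ^ 2) : Tendsto (fun k => y k - x k) atTop (𝓝 0) := by
  have hxx := h.isHaugazeau.tendsto_succ_sub (fun _ => convex_halfSpace _ _ _) hz
  have hxw := h.tendsto_succ_sub_wt hz hα hβ
  have hwy := h.tendsto_wt_sub_y hlam hL hlamL hC hBC hz hα hβ
  simpa using (hxx.sub hxw).sub hwy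

theorem tendsto_residual (h : IsRun F B C L lam α β x w wt w' y v ε) (hlam : 0 < lam)
    (hL : 0 < L) (hF : IsCocoercive F L) (hC : Convex ℝ C) (hBC : dom B ⊆ C)
    (hwy : Tendsto (fun k => wt k - y k) atTop (𝓝 0)) :
    Tendsto (fun k => F (y k) + (v k - F (w' k))) atTop (𝓝 0) := by
  have hv : Tendsto v atTop (𝓝 0) := by
    rw [funext h.v_eq]
    simpa using hwy.const_smul (1 / lam)
  have hFF : Tendsto (fun k => F (y k) - F (w' k)) atTop (𝓝 0) := by
    refine squeeze_zero_norm (fun k => ?_) (by simpa using hwy.norm.const_mul L)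
    exact (hF.norm_sub_le hL _ _).trans
      (mul_le_mul_of_nonneg_left (h.norm_y_sub_w'_le hlam.ne' hC hBC k) hL.le)
  rw [← add_zero (0 : H)]
  refine (hFF.add hv).congr fun k => ?_
  abel

theorem tendsto_x [CompleteSpace H] (h : IsRun F B C L lam α β x w wt w' y v ε)
    (hlam : 0 < lam) (hL : 0 < L) (hlamL : lam * L < 4) (hF : IsCocoercive F L)
    (hB : IsMaximalMonotone B) (hC : Convex ℝ C) (hBC : dom B ⊆ C)
    (hα : BddAbove (Set.range α)) (hβ : Summable fun k => β k ^ 2) {p : H}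
    (hp : IsProj (zeros (single F + B)) (x 0) p) : Tendsto x atTop (𝓝 p) := by
  have hH := h.mem_halfSpace hlam.ne' hL hF hB.1 hp.1
  have hyx := h.tendsto_y_sub_x hlam hL hlamL hC hBC hH hα hβ
  have hr := h.tendsto_residual hlam hL hF hC hBC
    (h.tendsto_wt_sub_y hlam hL hlamL hC hBC hH hα hβ)
  refine hp.tendsto_of_weak_cluster_mem (convex_zeros hF hL hB)
    (h.isHaugazeau.norm_sub_start_le (fun _ => convex_halfSpace _ _ _) hH) fun 𝒰 a h𝒰 ha => ?_
  exact mem_zeros_of_bddWeakTendsto hF hL hB ⟨p, hp.1⟩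
    (ha.congr_of_tendsto_sub (hyx.mono_left h𝒰)) (h.sub_mem hlam.ne') (hr.mono_left h𝒰)

theorem exists_norm_wt_sub_y_le (h : IsRun F B C L lam α β x w wt w' y v ε) (hlam : 0 < lam)
    (hL : 0 < L) (hlamL : lam * L < 4) (hC : Convex ℝ C) (hBC : dom B ⊆ C) {S : Set H}
    (hS : S.Nonempty) (hSH : ∀ z ∈ S, ∀ k, z ∈ halfSpace (y k) (v k) (ε k))
    (hα : BddAbove (Set.range α)) (hβ : Summable fun k => β k ^ 2) (k : ℕ) :
    ∃ j ≤ k, ‖wt j - y j‖ ≤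
      √(2 * boundConst (⨆ i, α i) (⨆ i, β i) (∑' i, β i ^ 2)) * Metric.infDist (x 0) S /
        (√((k : ℝ) + 1) * (1 - lam * L / 4)) := by
  have hgap : 0 < 1 - lam * L / 4 := by linarith
  obtain ⟨j, hjk, hj⟩ := exists_card_mul_le_sum (fun i => ‖x (i + 1) - wt i‖ ^ 2) k
  refine ⟨j, hjk, (le_div_iff₀' (by positivity)).2 ?_⟩
  refine le_mul_infDist hS (Real.sqrt_nonneg _) fun z hz => ?_
  calc √((k : ℝ) + 1) * (1 - lam * L / 4) * ‖wt j - y j‖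
      ≤ √((k : ℝ) + 1) * ‖x (j + 1) - wt j‖ := by
        rw [mul_assoc]
        gcongr
        exact h.norm_wt_sub_y_le hlam hL hC hBC j
    _ = √(((k : ℝ) + 1) * ‖x (j + 1) - wt j‖ ^ 2) := by
        rw [Real.sqrt_mul (by positivity), Real.sqrt_sq (norm_nonneg _)]
    _ ≤ √(2 * boundConst (⨆ i, α i) (⨆ i, β i) (∑' i, β i ^ 2) * ‖x 0 - z‖ ^ 2) :=
        Real.sqrt_le_sqrt (hj.trans (h.sum_sq_norm_sub_wt_le (hSH z hz) hα hβ (k + 1)))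
    _ = √(2 * boundConst (⨆ i, α i) (⨆ i, β i) (∑' i, β i ^ 2)) * dist (x 0) z := by
        rw [Real.sqrt_mul' _ (sq_nonneg _), Real.sqrt_sq (norm_nonneg _), dist_eq_norm]

theorem exists_norm_v_le_and_ε_le (h : IsRun F B C L lam α β x w wt w' y v ε) (hlam : 0 < lam)
    (hL : 0 < L) (hlamL : lam * L < 4) (hC : Convex ℝ C) (hBC : dom B ⊆ C) {S : Set H}
    (hS : S.Nonempty) (hSH : ∀ z ∈ S, ∀ k, z ∈ halfSpace (y k) (v k) (ε k))
    (hα : BddAbove (Set.range α)) (hβ : Summable fun k => β k ^ 2) (k : ℕ) :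
    ∃ j ≤ k,
      ‖v j‖ ≤ Metric.infDist (x 0) S / √((k : ℝ) + 1) *
        (√(2 * boundConst (⨆ i, α i) (⨆ i, β i) (∑' i, β i ^ 2)) /
          (lam * (1 - lam * L / 4))) ∧
      ε j ≤ Metric.infDist (x 0) S ^ 2 * L / ((k : ℝ) + 1) *
        (boundConst (⨆ i, α i) (⨆ i, β i) (∑' i, β i ^ 2) / (2 * (1 - lam * L / 4) ^ 2)) := by
  obtain ⟨j, hjk, hj⟩ := h.exists_norm_wt_sub_y_le hlam hL hlamL hC hBC hS hSH hα hβ k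
  have hK := h.boundConst_nonneg
  set K := boundConst (⨆ i, α i) (⨆ i, β i) (∑' i, β i ^ 2)
  set d := Metric.infDist (x 0) S
  refine ⟨j, hjk, ?_, ?_⟩
  · calc ‖v j‖ = lam⁻¹ * ‖wt j - y j‖ := h.norm_v_eq hlam j
      _ ≤ lam⁻¹ * (√(2 * K) * d / (√((k : ℝ) + 1) * (1 - lam * L / 4))) := by gcongr
      _ = d / √((k : ℝ) + 1) * (√(2 * K) / (lam * (1 - lam * L / 4))) := by field_simp
  · calc ε j ≤ L / 4 * ‖wt j - y j‖ ^ 2 := h.ε_le hlam.ne' hL hC hBC j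
      _ ≤ L / 4 * (√(2 * K) * d / (√((k : ℝ) + 1) * (1 - lam * L / 4))) ^ 2 := by gcongr
      _ = L / 4 * (2 * K * d ^ 2 / (((k : ℝ) + 1) * (1 - lam * L / 4) ^ 2)) := by
          rw [div_pow, mul_pow, mul_pow, Real.sq_sqrt (by positivity),
            Real.sq_sqrt (by positivity)]
      _ = d ^ 2 * L / ((k : ℝ) + 1) * (K / (2 * (1 - lam * L / 4) ^ 2)) := by
          field_simp
          norm_num

end IsRun

section StepSize

variable {L σ K d : ℝ}

theorem step_mul_lt_four (hL : L ≠ 0) (hσ0 : 0 < σ) (hσ1 : σ < 1) : 2 * σ ^ 2 / L * L < 4 := by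
  rw [div_mul_cancel₀ _ hL]
  nlinarith

theorem one_sub_step_mul_div_four (hL : L ≠ 0) :
    1 - 2 * σ ^ 2 / L * L / 4 = 1 - σ ^ 2 / 2 := by
  rw [div_mul_cancel₀ _ hL]
  ring

theorem residual_bound_le (hL : 0 < L) (hσ0 : 0 < σ) (hσ1 : σ < 1) (hd : 0 ≤ d) (n : ℝ) :
    d / √n * (√(2 * K) / (2 * σ ^ 2 / L * (1 - 2 * σ ^ 2 / L * L / 4))) ≤
      2 * d * L / √n * (√K / (2 * (1 - σ ^ 2) * σ ^ 2)) := by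
  have hgap : 0 < 1 - σ ^ 2 := by nlinarith
  have hsqrt : √(2 * K) ≤ 2 * √K := by
    rw [Real.sqrt_mul zero_le_two]
    gcongr
    exact Real.sqrt_le_iff.2 (by norm_num)
  rw [one_sub_step_mul_div_four hL.ne']
  calc d / √n * (√(2 * K) / (2 * σ ^ 2 / L * (1 - σ ^ 2 / 2)))
      ≤ d / √n * (2 * √K / (2 * σ ^ 2 / L * (1 - σ ^ 2))) := by
        gcongr
        linarith [sq_nonneg σ]
    _ = 2 * d * L / √n * (√K / (2 * (1 - σ ^ 2) * σ ^ 2)) := by field_simp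

theorem error_bound_le {n : ℝ} (hL : 0 < L) (hσ0 : 0 < σ) (hσ1 : σ < 1) (hK : 0 ≤ K)
    (hn : 0 ≤ n) :
    d ^ 2 * L / n * (K / (2 * (1 - 2 * σ ^ 2 / L * L / 4) ^ 2)) ≤
      d ^ 2 * L / n * (4 * σ ^ 2 * K / (2 * (1 - σ ^ 2) ^ 2 * σ ^ 2)) := by
  have hgap : 0 < 1 - σ ^ 2 := by nlinarith
  rw [one_sub_step_mul_div_four hL.ne']
  calc d ^ 2 * L / n * (K / (2 * (1 - σ ^ 2 / 2) ^ 2))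
      ≤ d ^ 2 * L / n * (4 * K / (2 * (1 - σ ^ 2) ^ 2)) := by
        gcongr
        · linarith
        · linarith [sq_nonneg σ]
    _ = d ^ 2 * L / n * (4 * σ ^ 2 * K / (2 * (1 - σ ^ 2) ^ 2 * σ ^ 2)) := by field_simp

end StepSize

end InertialFB

open InertialFB in
theorem theorem5p2_general {H : Type*} [NormedAddCommGroup H] [InnerProductSpace ℝ H]
    [CompleteSpace H] {F : H → H} {B : H → Set H} {C : Set H} {L lam : ℝ}
    (hL : 0 < L) (hlam : 0 < lam) (hlamL : lam * L < 4) (hF : IsCocoercive F L)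
    (hB : IsMaximalMonotone B) (hC : Convex ℝ C) (hBC : dom B ⊆ C)
    (hne : (zeros (single F + B)).Nonempty)
    {α β : ℕ → ℝ} {x w wt w' y v : ℕ → H} {ε : ℕ → ℝ}
    (h : IsRun F B C L lam α β x w wt w' y v ε)
    (hα : BddAbove (Set.range α)) (hβ : Summable fun k => β k ^ 2) :
    ((∃! p, IsProj (zeros (single F + B)) (x 0) p) ∧
      ∀ p, IsProj (zeros (single F + B)) (x 0) p →
        Tendsto x atTop (𝓝 p) ∧ Tendsto y atTop (𝓝 p)) ∧
    ∀ k : ℕ, ∃ j ≤ k,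
      v j ∈ (enlargement (single F) (ε j) + B) (y j) ∧
      ‖v j‖ ≤ Metric.infDist (x 0) (zeros (single F + B)) / √((k : ℝ) + 1) *
        (√(2 * boundConst (⨆ i, α i) (⨆ i, β i) (∑' i, β i ^ 2)) /
          (lam * (1 - lam * L / 4))) ∧
      ε j ≤ Metric.infDist (x 0) (zeros (single F + B)) ^ 2 * L / ((k : ℝ) + 1) *
        (boundConst (⨆ i, α i) (⨆ i, β i) (∑' i, β i ^ 2) / (2 * (1 - lam * L / 4) ^ 2)) := by
  have hSH : ∀ z ∈ zeros (single F + B), ∀ k, z ∈ halfSpace (y k) (v k) (ε k) :=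
    fun _ hz => h.mem_halfSpace hlam.ne' hL hF hB.1 hz
  refine ⟨⟨existsUnique_isProj hne (isClosed_zeros hF hL hB) (convex_zeros hF hL hB) _,
    fun p hp => ?_⟩, fun k => ?_⟩
  · have hx := h.tendsto_x hlam hL hlamL hF hB hC hBC hα hβ hp
    have hyx := h.tendsto_y_sub_x hlam hL hlamL hC hBC (hSH p hp.1) hα hβ
    exact ⟨hx, by simpa using hyx.add hx⟩
  · obtain ⟨j, hjk, hv, hε⟩ := h.exists_norm_v_le_and_ε_le hlam hL hlamL hC hBC hne hSH hα hβ k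
    exact ⟨j, hjk, h.mem_enlargement_add hlam.ne' hL hF j, hv, hε⟩

theorem theorem5p2 {H : Type*} [NormedAddCommGroup H] [InnerProductSpace ℝ H] [CompleteSpace H]
    (F : H → H) (B : H → Set H) (C S : Set H) (L σ : ℝ)
    (hL : 0 < L) (hF : InertialFB.IsCocoercive F L)
    (hB : InertialFB.IsMaximalMonotone B)
    (hCne : C.Nonempty) (hCcl : IsClosed C) (hCconv : Convex ℝ C)
    (hBC : InertialFB.dom B ⊆ C)
    (hS : S = InertialFB.zeros (InertialFB.single F + B)) (hSne : S.Nonempty)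
    (hσ0 : 0 < σ) (hσ1 : σ < 1)
    (α β : ℕ → ℝ) (x w wt w' y v : ℕ → H) (ε : ℕ → ℝ)
    (hrun : InertialFB.IsRun F B C L (2 * σ ^ 2 / L) α β x w wt w' y v ε)
    (hα : BddAbove (Set.range α)) (hβ : Summable fun k => β k ^ 2) :
    ((∃! p, InertialFB.IsProj S (x 0) p) ∧
      ∀ p, InertialFB.IsProj S (x 0) p →
        Tendsto x atTop (𝓝 p) ∧ Tendsto y atTop (𝓝 p)) ∧
    ∀ k : ℕ, ∃ j ≤ k,
      v j ∈ (InertialFB.enlargement (InertialFB.single F) (ε j) + B) (y j) ∧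
      ‖v j‖ ≤ 2 * Metric.infDist (x 0) S * L / √((k : ℝ) + 1) *
        (√(InertialFB.boundConst (⨆ i, α i) (⨆ i, β i) (∑' i, β i ^ 2)) /
          (2 * (1 - σ ^ 2) * σ ^ 2)) ∧
      ε j ≤ Metric.infDist (x 0) S ^ 2 * L / ((k : ℝ) + 1) *
        (4 * σ ^ 2 * InertialFB.boundConst (⨆ i, α i) (⨆ i, β i) (∑' i, β i ^ 2) /
          (2 * (1 - σ ^ 2) ^ 2 * σ ^ 2)) := by
  subst hS
  refine (theorem5p2_general hL (by positivity) (InertialFB.step_mul_lt_four hL.ne' hσ0 hσ1)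
    hF hB hCconv hBC hSne hrun hα hβ).imp_right fun h k => ?_
  obtain ⟨j, hjk, hmem, hv, hε⟩ := h k
  exact ⟨j, hjk, hmem,
    hv.trans (InertialFB.residual_bound_le hL hσ0 hσ1 Metric.infDist_nonneg _),
    hε.trans (InertialFB.error_bound_le hL hσ0 hσ1 hrun.boundConst_nonneg (by positivity))⟩
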